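/- Theorem 4.4 (Theorem D). There exist absolute constants $c_1,c_2>0$ such that the following holds. Let $n\ge 1$, let $\{e_1,\dots,e_n\}$ be an orthonormal basis of $\mathbf R^n$, let $K\subset\mathbf R^n$ be a symmetric convex body (a compact convex set with non-empty interior and $K=-K$), and let $\theta\in(0,1)$. Then there is $\sigma\subseteq\{1,\dots,n\}$ with $|\sigma|\ge(1-\theta)n$ such that $$P_\sigma(K)\supseteq \frac{1}{[c_1\,\mathrm{vr}(K)]^{\frac{c_2\log(2/\theta)}{\theta}}\,M_K}\,D_\sigma .$$ Here $\mathbf R^\sigma=\{x\in\mathbf R^n:\langle x,e_j\rangle=0 \text{ for } j\notin\sigma\}$, $P_\sigma$ is the orthogonal projection onto $\mathbf R^\sigma$, and $D_\sigma=\{x\in\mathbf R^\sigma:|x|\le 1\}$ is the Euclidean unit ball of $\mathbf R^\sigma$; $M_K=\left(\int_{S^{n-1}}\|x\|_K^2\,d\mu(x)\right)^{1/2}$, where $\|\cdot\|_K$ is the norm with unit ball $K$ and $\mu$ is the rotation invariant probability measure on the unit sphere $S^{n-1}$; and $\mathrm{vr}(K)=(|K|/|E|)^{1/n}$, where $E$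 is the ellipsoid of maximal volume contained in $K$ and $|\cdot|$ applied to a body is its volume. -/

import Mathlib

open MeasureTheory Metric Set
open scoped Pointwise RealInnerProductSpace

noncomputable section

/-- The rotation invariant probability measure on the unit sphere of `ℝⁿ`: the normalized
surface measure. -/
def sphereProbability (n : ℕ) :
    Measure (sphere (0 : EuclideanSpace ℝ (Fin n)) 1) :=
  ((volume : Measure (EuclideanSpace ℝ (Fin n))).toSphere univ)⁻¹ •
    (volume : Measure (EuclideanSpace ℝ (Fin n))).toSphere

/-- `M_K = (∫_{S^{n-1}} ‖x‖_K² dσ(x))^{1/2}`, where `‖x‖_K` is the Minkowski gauge of `K`. -/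
def meanNorm {n : ℕ} (K : Set (EuclideanSpace ℝ (Fin n))) : ℝ :=
  √(∫ x : sphere (0 : EuclideanSpace ℝ (Fin n)) 1,
      gauge K (x : EuclideanSpace ℝ (Fin n)) ^ 2 ∂(sphereProbability n))

/-- An (origin-centred, nondegenerate) ellipsoid: the image of the closed Euclidean unit ball
under a linear isomorphism. -/
def IsEllipsoid {n : ℕ} (E : Set (EuclideanSpace ℝ (Fin n))) : Prop :=
  ∃ T : EuclideanSpace ℝ (Fin n) ≃L[ℝ] EuclideanSpace ℝ (Fin n), E = T '' closedBall 0 1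

/-- `E` is a maximal volume ellipsoid of `K`. -/
def IsMaxVolumeEllipsoid {n : ℕ} (E K : Set (EuclideanSpace ℝ (Fin n))) : Prop :=
  (IsEllipsoid E ∧ E ⊆ K) ∧
    ∀ E', IsEllipsoid E' → E' ⊆ K → volume.real E' ≤ volume.real E

/-- The maximal volume of an ellipsoid contained in `K`. -/
def maxEllipsoidVolume {n : ℕ} (K : Set (EuclideanSpace ℝ (Fin n))) : ℝ :=
  sSup {v : ℝ | ∃ E, IsEllipsoid E ∧ E ⊆ K ∧ v = volume.real E}

/-- The volume ratio `vr(K) = (|K| / |E|)^{1/n}`, where `E` is the maximal volume ellipsoid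
of `K`. -/
def volumeRatio {n : ℕ} (K : Set (EuclideanSpace ℝ (Fin n))) : ℝ :=
  (volume.real K / maxEllipsoidVolume K) ^ (1 / (n : ℝ))

/-- The supremum defining `volumeRatio` is the volume of any maximal volume ellipsoid. -/
theorem volumeRatio_eq {n : ℕ} {E K : Set (EuclideanSpace ℝ (Fin n))}
    (h : IsMaxVolumeEllipsoid E K) :
    volumeRatio K = (volume.real K / volume.real E) ^ (1 / (n : ℝ)) := by
  have : IsGreatest {v : ℝ | ∃ E, IsEllipsoid E ∧ E ⊆ K ∧ v = volume.real E}
      (volume.real E) :=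
    ⟨⟨E, h.1.1, h.1.2, rfl⟩, by rintro _ ⟨E', h1, h2, rfl⟩; exact h.2 E' h1 h2⟩
  rw [volumeRatio, maxEllipsoidVolume, this.csSup_eq]

/-- A symmetric convex body has a maximal volume ellipsoid. -/
theorem exists_isMaxVolumeEllipsoid {n : ℕ} (K : ConvexBody (EuclideanSpace ℝ (Fin n)))
    (hsymm : ∀ x ∈ K, -x ∈ K) (hint : (interior (K : Set (EuclideanSpace ℝ (Fin n)))).Nonempty) :
    ∃ E, IsMaxVolumeEllipsoid E (K : Set (EuclideanSpace ℝ (Fin n))) := by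
  set V := EuclideanSpace ℝ (Fin n) with hV
  -- a small ball centred at the origin lies in the body
  obtain ⟨r, hr, hrK⟩ : ∃ r > 0, closedBall (0 : V) r ⊆ K := by
    obtain ⟨x, hx⟩ := hint
    obtain ⟨r, hr, hb⟩ := Metric.nhds_basis_closedBall.mem_iff.1 (mem_interior_iff_mem_nhds.1 hx)
    refine ⟨r, hr, fun y hy => ?_⟩
    have h1 : x + y ∈ (K : Set V) := hb (by simpa [mem_closedBall, dist_eq_norm] using hy)
    have h2 : -x ∈ (K : Set V) := hsymm x (interior_subset hx)
    have h3 : -(x - y) ∈ (K : Set V) := by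
      apply hsymm
      have : x - y ∈ (K : Set V) := hb (by simpa [mem_closedBall, dist_eq_norm] using hy)
      exact this
    have h4 := K.convex h1 h3 (by norm_num : (0 : ℝ) ≤ 1 / 2) (by norm_num : (0 : ℝ) ≤ 1 / 2)
      (by norm_num)
    have h5 : (1 / 2 : ℝ) • (x + y) + (1 / 2 : ℝ) • -(x - y) = y := by module
    rwa [h5] at h4
  -- the linear maps sending the unit ball into the body form a compact set
  let S : Set (V →L[ℝ] V) := {T | ∀ x ∈ closedBall (0 : V) 1, T x ∈ (K : Set V)}
  have hSc : IsClosed S := by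
    have : S = ⋂ x ∈ closedBall (0 : V) 1, (fun T : V →L[ℝ] V => T x) ⁻¹' (K : Set V) := by
      ext T; simp [S]
    rw [this]
    exact isClosed_biInter fun x _ => K.isCompact.isClosed.preimage (by fun_prop)
  have hSb : Bornology.IsBounded S := by
    obtain ⟨C, hC⟩ := K.isCompact.isBounded.exists_norm_le
    refine isBounded_iff_forall_norm_le.2 ⟨C, fun T hT => ?_⟩
    have hC0 : 0 ≤ C := le_trans (norm_nonneg _) (hC (T 0) (hT 0 (by simp)))
    refine ContinuousLinearMap.opNorm_le_of_unit_norm hC0 fun x hx => ?_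
    exact hC _ (hT x (by simp [hx]))
  have hScomp : IsCompact S := Metric.isCompact_of_isClosed_isBounded hSc hSb
  have hrS : r • ContinuousLinearMap.id ℝ V ∈ S := by
    intro x hx
    apply hrK
    simp only [mem_closedBall, dist_zero_right] at hx ⊢
    simp only [_root_.smul_apply, ContinuousLinearMap.id_apply, norm_smul,
      Real.norm_eq_abs, abs_of_pos hr]
    nlinarith
  obtain ⟨T, hTS, hT⟩ := hScomp.exists_isMaxOn ⟨_, hrS⟩
    (f := fun T : V →L[ℝ] V => |T.det|)
    (ContinuousLinearMap.continuous_det.abs.continuousOn)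
  have hvol : ∀ A : V →L[ℝ] V,
      volume.real (A '' closedBall (0 : V) 1) = |A.det| * volume.real (closedBall (0 : V) 1) := by
    intro A
    rw [measureReal_def, Measure.addHaar_image_continuousLinearMap, ENNReal.toReal_mul,
      ENNReal.toReal_ofReal (abs_nonneg _), measureReal_def]
  have hdet : T.det ≠ 0 := by
    have h := hT hrS
    have h2 : (r • ContinuousLinearMap.id ℝ V).det ≠ 0 := by
      simp [ContinuousLinearMap.det, hr.ne']
    intro h0
    simp only [mem_ofPred_eq, h0, abs_zero] at h
    exact h2 (abs_nonpos_iff.1 h)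
  refine ⟨T '' closedBall 0 1, ⟨⟨T.toContinuousLinearEquivOfDetNeZero hdet, ?_⟩, ?_⟩, ?_⟩
  · ext; simp [V]
  · rintro _ ⟨x, hx, rfl⟩; exact hTS x hx
  · rintro _ ⟨A, rfl⟩ hA
    have hAS : (A : V →L[ℝ] V) ∈ S := fun x hx => hA ⟨x, hx, rfl⟩
    have e : (A '' closedBall (0 : V) 1) = (A : V →L[ℝ] V) '' closedBall (0 : V) 1 := by
      ext; simp
    rw [e, hvol, hvol]
    exact mul_le_mul_of_nonneg_right (hT hAS) measureReal_nonneg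

/-- The coordinate subspace `ℝ^σ = {x : ⟪x, e_j⟫ = 0 for all j ∉ σ}` with respect to the
orthonormal basis `e`. -/
def coordSubspace {n : ℕ}
    (e : OrthonormalBasis (Fin n) ℝ (EuclideanSpace ℝ (Fin n))) (σ : Finset (Fin n)) :
    Submodule ℝ (EuclideanSpace ℝ (Fin n)) where
  carrier := {x | ∀ j, j ∉ σ → ⟪x, e j⟫ = 0}
  add_mem' := fun hx hy j hj => by rw [inner_add_left, hx j hj, hy j hj, add_zero]
  zero_mem' := fun j _ => inner_zero_left (e j)
  smul_mem' := fun c x hx j hj => by rw [inner_smul_left, hx j hj, mul_zero]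

/-- `D_σ`, the Euclidean unit ball of `ℝ^σ`. -/
def coordBall {n : ℕ}
    (e : OrthonormalBasis (Fin n) ℝ (EuclideanSpace ℝ (Fin n))) (σ : Finset (Fin n)) :
    Set (EuclideanSpace ℝ (Fin n)) :=
  closedBall 0 1 ∩ (coordSubspace e σ : Set (EuclideanSpace ℝ (Fin n)))

/-- `P_σ(K)`, the image of `K` under the orthogonal projection onto `ℝ^σ`. -/
def coordProj {n : ℕ}
    (e : OrthonormalBasis (Fin n) ℝ (EuclideanSpace ℝ (Fin n))) (σ : Finset (Fin n))
    (K : Set (EuclideanSpace ℝ (Fin n))) : Set (EuclideanSpace ℝ (Fin n)) :=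
  (coordSubspace e σ).starProjection '' K

end

/-! Let `E ⊆ K` be the ellipsoid of maximal volume, with orthonormal axes `f i` of lengths `l i`, and
write `v = vr(K)`, `M = M_K`. The required ball in `ℝ^σ` is found already in `P_σ(E)`.

Few axes of `E` are short (`card_small_axes_le`). Put `ρ = 1 / (√2 M)`. By Markov's inequality
`L = K ∩ ρB` has at least half of the volume of `ρB`, and `E + L ⊆ 2K` by convexity. For a set `J` of
axes, each section of `E + L` with prescribed coordinates in `J` that meets `L` contains a translate of
a section of `E`, and integrating over these coordinates gives `∏_{i ∈ J} ρ / l i ≤ 2 (2 v)ⁿ`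
(`prod_div_axes_mul_volume_le`). So all but at most `θ n / 8` of the `l i` are at least
`r₀ = ρ (4 v) ^ (-8 / θ)`.

An ellipsoid with few short axes has a large coordinate projection
(`exists_coordinate_ball_in_ellipsoid`). By duality, `P_σ(E) ⊇ r D_σ` follows once the form
`x ↦ ∑ (l i)² ⟪f i, x⟫²` is at least `r² ‖x‖²` on `ℝ^σ`. Such a `σ` is found by a barrier argument in
the spirit of Batson, Spielman and Srivastava (`exists_large_restricted_lower_bound`): for the matrix
`G` of the form, normalized by `r₀²`, and a barrier `b` below its spectrum, the potential
`tr (G - b)⁻¹` stays below a bound `Φ` when `b` is raised by `1 / (2 Φ)` and a suitable index is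
deleted. If at most `k` eigenvalues are below `1`, the potential at `b = -k / n` is at most `2 n`, so
after `8 k` deletions the barrier has reached `k / n > 0`. This gives `r = r₀ √θ / 4`; the factor `√θ`
and the constants are absorbed by the power of `4 v`. -/

/-! ### The barrier method for principal submatrices -/

theorem inv_submatrix_ne {ι : Type*} [Fintype ι] [DecidableEq ι] {N C : Matrix ι ι ℝ}
    (h : N * C = 1) (j : ι) (hj : C j j ≠ 0) :
    (N.submatrix (Subtype.val : {i // i ≠ j} → ι) Subtype.val)⁻¹ =
      Matrix.of fun a b : {i // i ≠ j} => C a b - C a j * C j b / C j j := by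
  have key : ∀ a b : ι, ∑ c : {i // i ≠ j}, N a c * C c b =
      (1 : Matrix ι ι ℝ) a b - N a j * C j b := by
    intro a b
    rw [← h, Matrix.mul_apply, ← Fintype.sum_subtype_add_sum_subtype (fun i => i ≠ j)]
    have : ∑ c : {i // ¬ (i ≠ j)}, N a c * C c b = N a j * C j b := by
      rw [Fintype.sum_eq_single (⟨j, by simp⟩ : {i // ¬ (i ≠ j)})]
      rintro ⟨x, hx⟩ hne
      exact absurd (Subtype.ext (not_not.1 hx)) hne
    rw [this, add_sub_cancel_right]
  refine Matrix.inv_eq_right_inv ?_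
  ext a b
  simp only [Matrix.mul_apply, Matrix.submatrix_apply, Matrix.of_apply, mul_sub,
    Finset.sum_sub_distrib]
  have e : ∀ c : {i // i ≠ j}, N a c * (C c j * C j b / C j j) =
      (N a c * C c j) * (C j b / C j j) := fun c => by ring
  simp only [e, ← Finset.sum_mul, key]
  rw [Matrix.one_apply_ne a.2]
  have e2 : (1 : Matrix ι ι ℝ) a b = (1 : Matrix {i // i ≠ j} {i // i ≠ j} ℝ) a b := by
    simp [Matrix.one_apply, Subtype.ext_iff]
  rw [e2]
  field_simp
  ring

theorem trace_inv_submatrix_ne {ι : Type*} [Fintype ι] [DecidableEq ι] {N C : Matrix ι ι ℝ}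
    (h : N * C = 1) (j : ι) (hj : C j j ≠ 0) :
    (N.submatrix (Subtype.val : {i // i ≠ j} → ι) Subtype.val)⁻¹.trace =
      C.trace - (C * C) j j / C j j := by
  rw [inv_submatrix_ne h j hj, Matrix.mul_apply]
  simp only [Matrix.trace, Matrix.diag_apply, Matrix.of_apply]
  rw [Finset.sum_div, ← Finset.sum_sub_distrib,
    ← Fintype.sum_subtype_add_sum_subtype (fun i => i ≠ j)
      (fun i => C i i - C j i * C i j / C j j)]
  have : ∑ c : {i // ¬ (i ≠ j)}, (C c c - C j c * C c j / C j j) = 0 := by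
    refine Finset.sum_eq_zero ?_
    rintro ⟨x, hx⟩ -
    obtain rfl := not_not.1 hx
    simp [hj]
  rw [this, add_zero]
  exact Finset.sum_congr rfl fun a _ => by ring

/-- Below the spectrum of a Hermitian matrix `M` the resolvent `(M - d)⁻¹` exists, and its first two
power traces are read off from the eigenvalues. -/
theorem exists_resolvent {ι : Type*} [Fintype ι] [DecidableEq ι]
    {M : Matrix ι ι ℝ} (hM : M.IsHermitian) (d : ℝ) (hd : ∀ i, 0 < hM.eigenvalues i - d) :
    (M - d • (1 : Matrix ι ι ℝ)).PosDef ∧ ∃ C : Matrix ι ι ℝ, (M - d • 1) * C = 1 ∧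
      C.trace = ∑ i, (hM.eigenvalues i - d)⁻¹ ∧
      (C * C).trace = ∑ i, (hM.eigenvalues i - d)⁻¹ ^ 2 := by
  set U : Matrix ι ι ℝ := (hM.eigenvectorUnitary : Matrix ι ι ℝ) with hU
  have hs : M = U * Matrix.diagonal hM.eigenvalues * star U := by
    have := hM.spectral_theorem
    rw [Unitary.conjStarAlgAut_apply] at this
    exact this
  have h1 : star U * U = 1 := Unitary.coe_star_mul_self hM.eigenvectorUnitary
  have h2 : U * star U = 1 := Unitary.coe_mul_star_self hM.eigenvectorUnitary
  have conj : ∀ A B : Matrix ι ι ℝ, U * A * star U * (U * B * star U) = U * (A * B) * star U := by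
    intro A B
    calc U * A * star U * (U * B * star U) = U * A * (star U * U) * B * star U := by
          simp only [Matrix.mul_assoc]
      _ = _ := by rw [h1]; simp only [Matrix.mul_assoc, Matrix.mul_one]
  have htr : ∀ A : Matrix ι ι ℝ, (U * A * star U).trace = A.trace := by
    intro A
    rw [Matrix.trace_mul_comm, ← Matrix.mul_assoc, h1, Matrix.one_mul]
  have hM' : M - d • 1 = U * Matrix.diagonal (fun i => hM.eigenvalues i - d) * star U := by
    have : Matrix.diagonal (fun i => hM.eigenvalues i - d) =
        Matrix.diagonal hM.eigenvalues - d • (1 : Matrix ι ι ℝ) := by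
      rw [Matrix.smul_one_eq_diagonal, Matrix.diagonal_sub]
    rw [this, Matrix.mul_sub, Matrix.sub_mul, ← hs]
    simp [h2]
  refine ⟨?_, U * Matrix.diagonal (fun i => (hM.eigenvalues i - d)⁻¹) * star U, ?_, ?_, ?_⟩
  · rw [hM', Matrix.IsUnit.posDef_star_right_conjugate_iff (IsUnit.of_mul_eq_one _ h2)]
    exact Matrix.PosDef.diagonal hd
  · rw [hM', conj, Matrix.diagonal_mul_diagonal]
    simp only [mul_inv_cancel₀ (hd _).ne']
    simp [h2]
  · rw [htr, Matrix.trace_diagonal]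
  · rw [conj, htr, Matrix.diagonal_mul_diagonal, Matrix.trace_diagonal]
    simp [sq]

/-- One step of the barrier method. Moving the barrier up by `1 / (2Φ)` raises the potential
`tr M⁻¹`, but deleting a suitable row and column lowers it at least as much. With `C` the shifted
inverse, deleting `j` subtracts `(C²)ⱼⱼ / Cⱼⱼ` from `tr C`; averaged with weights `Cⱼⱼ` this is
`tr C² / tr C`, which is at least the rise, since the rise is at most `tr C² / (2Φ)` and
`tr C ≤ 2Φ`. -/
theorem exists_remove_index {ι : Type*} [Fintype ι] [DecidableEq ι] [Nonempty ι]
    {M : Matrix ι ι ℝ} (hM : M.PosDef) {Φ : ℝ} (hΦ : 0 < Φ) (htr : M⁻¹.trace ≤ Φ) :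
    ∃ j : ι, ((M - (1 / (2 * Φ)) • (1 : Matrix ι ι ℝ)).submatrix
        (Subtype.val : {i // i ≠ j} → ι) Subtype.val).PosDef ∧
      ((M - (1 / (2 * Φ)) • (1 : Matrix ι ι ℝ)).submatrix
        (Subtype.val : {i // i ≠ j} → ι) Subtype.val)⁻¹.trace ≤ Φ := by
  set d : ℝ := 1 / (2 * Φ) with hd
  have hdpos : 0 < d := by positivity
  have hdΦ : 2 * Φ * d = 1 := by rw [hd]; field_simp
  set μ := hM.isHermitian.eigenvalues with hμdef
  have hμ : ∀ i, 0 < μ i := hM.eigenvalues_pos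
  -- the trace of the inverse controls the smallest eigenvalue
  have htr' : ∑ i, (μ i)⁻¹ ≤ Φ := by
    obtain ⟨-, C, hC, hC1, -⟩ := exists_resolvent hM.isHermitian 0
      (fun i => by simpa using hμ i)
    rw [zero_smul, sub_zero] at hC
    rw [Matrix.inv_eq_right_inv hC, hC1] at htr
    simpa using htr
  have hμd : ∀ i, 2 * d ≤ μ i := by
    intro i
    have h1 : (μ i)⁻¹ ≤ Φ := (Finset.single_le_sum (f := fun i => (μ i)⁻¹)
      (fun i _ => (inv_pos.2 (hμ i)).le) (Finset.mem_univ i)).trans htr'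
    have h2 : 1 ≤ Φ * μ i := by
      have := mul_le_mul_of_nonneg_right h1 (hμ i).le
      rwa [inv_mul_cancel₀ (hμ i).ne'] at this
    nlinarith
  have hpos : ∀ i, 0 < μ i - d := fun i => by linarith [hμd i]
  obtain ⟨hM'pd, C, hC, hC1, hC2⟩ := exists_resolvent hM.isHermitian d hpos
  set M' := M - d • (1 : Matrix ι ι ℝ) with hM'
  have hCinv : M'⁻¹ = C := Matrix.inv_eq_right_inv hC
  have hCpd : C.PosDef := hCinv ▸ hM'pd.inv
  have hCd : ∀ j, 0 < C j j := fun j => hCpd.diag_pos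
  set t := C.trace with ht
  have htpos : 0 < t := by
    rw [ht, Matrix.trace]
    exact Finset.sum_pos (fun j _ => hCd j) Finset.univ_nonempty
  have ht2 : t ≤ 2 * Φ := by
    rw [hC1]
    calc ∑ i, (μ i - d)⁻¹ ≤ ∑ i, 2 * (μ i)⁻¹ := by
          refine Finset.sum_le_sum fun i _ => ?_
          rw [inv_le_iff_one_le_mul₀ (hpos i)]
          have := hμd i
          have := hμ i
          field_simp
          linarith
      _ ≤ 2 * Φ := by rw [← Finset.mul_sum]; linarith
  -- the rise is estimated through `C - M⁻¹ = d C M⁻¹`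
  have hgain : t - (C * C).trace / t ≤ Φ := by
    have h1 : t - ∑ i, (μ i)⁻¹ ≤ d * (C * C).trace := by
      rw [hC1, hC2, Finset.mul_sum, ← Finset.sum_sub_distrib]
      refine Finset.sum_le_sum fun i _ => ?_
      have e : (μ i - d)⁻¹ - (μ i)⁻¹ = d * (μ i - d)⁻¹ * (μ i)⁻¹ := by
        have := (hpos i).ne'
        have := (hμ i).ne'
        field_simp
        ring
      rw [e, sq, ← mul_assoc]
      have : (μ i)⁻¹ ≤ (μ i - d)⁻¹ := inv_anti₀ (hpos i) (by linarith)
      exact mul_le_mul_of_nonneg_left this (mul_nonneg hdpos.le (inv_pos.2 (hpos i)).le)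
    have h2 : d * (C * C).trace ≤ (C * C).trace / t := by
      have h0 : 0 ≤ (C * C).trace := by
        rw [hC2]; exact Finset.sum_nonneg fun i _ => sq_nonneg _
      rw [le_div_iff₀ htpos]
      have : d * t ≤ 1 := by nlinarith
      nlinarith
    linarith
  obtain ⟨j, -, hj⟩ : ∃ j ∈ Finset.univ, C j j * (t - (C * C) j j / C j j) ≤
      C j j * (t - (C * C).trace / t) := by
    refine Finset.exists_le_of_sum_le Finset.univ_nonempty ?_
    have e1 : ∑ j, C j j * (t - (C * C) j j / C j j) = t * t - (C * C).trace := by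
      have : ∀ j, C j j * (t - (C * C) j j / C j j) = C j j * t - (C * C) j j := fun j => by
        have := (hCd j).ne'
        field_simp
      simp only [this, Finset.sum_sub_distrib, ← Finset.sum_mul]
      rfl
    have e2 : ∑ j, C j j * (t - (C * C).trace / t) = t * t - (C * C).trace := by
      rw [← Finset.sum_mul]
      change t * _ = _
      field_simp
    rw [e1, e2]
  refine ⟨j, hM'pd.submatrix Subtype.val_injective, ?_⟩
  rw [trace_inv_submatrix_ne hC j (hCd j).ne']
  exact (le_of_mul_le_mul_left hj (hCd j)).trans hgain

/-- The barrier method: deleting `N` indices raises a lower bound `b` for the symmetric matrix `G` by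
`N / (2Φ)`, where `Φ` bounds `tr (G - b)⁻¹`. The bound `b` may be negative at the start. -/
theorem exists_large_restricted_lower_bound {Φ : ℝ} (hΦ : 0 < Φ) (N : ℕ) :
    ∀ {ι : Type*} [Fintype ι] [DecidableEq ι] (G : Matrix ι ι ℝ) (b : ℝ),
      (G - b • (1 : Matrix ι ι ℝ)).PosDef → (G - b • (1 : Matrix ι ι ℝ))⁻¹.trace ≤ Φ →
      ∃ s : Finset ι, Fintype.card ι ≤ s.card + N ∧
        ∀ x : ι → ℝ, (∀ i ∉ s, x i = 0) →
          (b + N * (1 / (2 * Φ))) * (x ⬝ᵥ x) ≤ x ⬝ᵥ (G.mulVec x) := by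
  induction N with
  | zero =>
    intro ι _ _ G b hG _
    refine ⟨Finset.univ, by simp, fun x _ => ?_⟩
    have := hG.posSemidef.dotProduct_mulVec_nonneg x
    simp only [star_trivial, Matrix.sub_mulVec, Matrix.smul_mulVec, Matrix.one_mulVec,
      dotProduct_sub, dotProduct_smul, smul_eq_mul] at this
    simp only [Nat.cast_zero, zero_mul, add_zero]
    linarith
  | succ N ih =>
    intro ι _ _ G b hG htr
    cases isEmpty_or_nonempty ι with
    | inl h => exact ⟨∅, by simp, fun x _ => by simp [dotProduct]⟩
    | inr h =>
      obtain ⟨j, hj1, hj2⟩ := exists_remove_index hG hΦ htr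
      set d := 1 / (2 * Φ) with hd
      have e : (G - b • (1 : Matrix ι ι ℝ) - d • (1 : Matrix ι ι ℝ)).submatrix
          (Subtype.val : {i // i ≠ j} → ι) Subtype.val =
          G.submatrix (Subtype.val : {i // i ≠ j} → ι) Subtype.val -
            (b + d) • (1 : Matrix {i // i ≠ j} {i // i ≠ j} ℝ) := by
        ext a c
        simp only [Matrix.submatrix_apply, Matrix.sub_apply, Matrix.smul_apply,
          Matrix.one_apply, Subtype.ext_iff, smul_eq_mul]
        split_ifs <;> ring
      rw [e] at hj1 hj2
      obtain ⟨s, hs, hx⟩ := ih _ _ hj1 hj2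
      refine ⟨s.map (Function.Embedding.subtype _), ?_, fun x hx0 => ?_⟩
      · rw [Finset.card_map]
        have : Fintype.card {i // i ≠ j} = Fintype.card ι - 1 := by
          simp [Fintype.card_subtype_compl]
        omega
      · have hxj : x j = 0 := hx0 j (by simp)
        have hsum : ∀ f : ι → ℝ, ∑ i, x i * f i = ∑ i : {i // i ≠ j}, x i * f i := by
          intro f
          rw [← Fintype.sum_subtype_add_sum_subtype (fun i => i ≠ j)]
          rw [add_eq_left]
          refine Finset.sum_eq_zero ?_
          rintro ⟨y, hy⟩ -
          obtain rfl := not_not.1 hy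
          simp [hxj]
        have h1 := hx (fun i => x i) (fun i hi => hx0 i (by simpa using fun _ => hi))
        have e1 : x ⬝ᵥ x = (fun i : {i // i ≠ j} => x i) ⬝ᵥ (fun i => x i) := hsum x
        have e2 : x ⬝ᵥ G.mulVec x = (fun i : {i // i ≠ j} => x i) ⬝ᵥ
            (G.submatrix (Subtype.val : {i // i ≠ j} → ι)
              (Subtype.val : {i // i ≠ j} → ι)).mulVec (fun i => x i) := by
          refine (hsum _).trans (Finset.sum_congr rfl fun a _ => ?_)
          congr 1
          simp only [Matrix.mulVec, dotProduct, Matrix.submatrix_apply, mul_comm (G _ _)]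
          exact hsum _
        rw [e1, e2]
        push_cast
        convert h1 using 2
        ring

/-! ### Restricted invertibility -/

/-- Restricted invertibility for a quadratic form with few small eigenvalues. If all but `k` of the
eigenvalues `w i` are at least `1`, then the form is bounded below by `k / n` on a coordinate subspace
of codimension at most `8k`, whatever the position of the eigenvectors `f i` with respect to `e`. -/
theorem exists_coordinate_lower_bound {V ι : Type*} [NormedAddCommGroup V]
    [InnerProductSpace ℝ V] [Fintype ι] (e f : OrthonormalBasis ι ℝ V)
    (w : ι → ℝ) (hw : ∀ i, 0 ≤ w i) {k : ℕ} (hk : 0 < k)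
    (hcard : (Finset.univ.filter fun i => w i < 1).card ≤ k) :
    ∃ s : Finset ι, Fintype.card ι ≤ s.card + 8 * k ∧
      ∀ x : V, (∀ j ∉ s, ⟪x, e j⟫ = 0) →
        (k / Fintype.card ι : ℝ) * ‖x‖ ^ 2 ≤ ∑ i, w i * ⟪f i, x⟫ ^ 2 := by
  classical
  cases isEmpty_or_nonempty ι with
  | inl h => exact ⟨∅, by simp, fun x _ => by simp⟩
  | inr h =>
  set n : ℝ := (Fintype.card ι : ℝ) with hn
  have hn0 : 0 < n := by rw [hn]; exact_mod_cast Fintype.card_pos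
  have hk0 : (0 : ℝ) < k := by exact_mod_cast hk
  -- at the barrier `-β` the at most `k` small eigenvalues contribute at most `k / β = n` to the
  -- potential, and so do the other ones
  set β : ℝ := k / n with hβ
  have hβ0 : 0 < β := by positivity
  set U : Matrix ι ι ℝ := Matrix.of fun i j => ⟪f i, e j⟫ with hU
  have h1 : U.transpose * U = 1 := by
    ext a b
    rw [Matrix.mul_apply]
    simp only [hU, Matrix.transpose_apply, Matrix.of_apply]
    have := f.sum_inner_mul_inner (e a) (e b)
    simp only [real_inner_comm (f _) (e a)] at this
    simp only [real_inner_comm (e a) (f _)] at this ⊢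
    rw [this, Matrix.one_apply]
    exact orthonormal_iff_ite.1 e.orthonormal a b
  have h2 : U * U.transpose = 1 := mul_eq_one_comm.1 h1
  have hpos : ∀ i, 0 < w i + β := fun i => by linarith [hw i]
  set G : Matrix ι ι ℝ := U.transpose * Matrix.diagonal w * U with hG
  have hGb : G - (-β) • (1 : Matrix ι ι ℝ) =
      U.transpose * Matrix.diagonal (fun i => w i + β) * U := by
    have : Matrix.diagonal (fun i => w i + β) =
        Matrix.diagonal w + β • (1 : Matrix ι ι ℝ) := by
      rw [Matrix.smul_one_eq_diagonal, Matrix.diagonal_add]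
    rw [this, Matrix.mul_add, Matrix.add_mul]
    simp [h1, hG]
  have hpd : (G - (-β) • (1 : Matrix ι ι ℝ)).PosDef := by
    rw [hGb]
    exact (Matrix.IsUnit.posDef_star_left_conjugate_iff (U := U) (IsUnit.of_mul_eq_one _ h2)).2
      (Matrix.PosDef.diagonal hpos)
  have hinv : (G - (-β) • (1 : Matrix ι ι ℝ))⁻¹ =
      U.transpose * Matrix.diagonal (fun i => (w i + β)⁻¹) * U := by
    refine Matrix.inv_eq_right_inv ?_
    rw [hGb]
    calc _ = U.transpose * Matrix.diagonal (fun i => w i + β) * (U * U.transpose) *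
          Matrix.diagonal (fun i => (w i + β)⁻¹) * U := by simp only [Matrix.mul_assoc]
      _ = U.transpose * (Matrix.diagonal (fun i => w i + β) *
          Matrix.diagonal (fun i => (w i + β)⁻¹)) * U := by
          rw [h2]; simp only [Matrix.mul_assoc, Matrix.one_mul]
      _ = 1 := by
          rw [Matrix.diagonal_mul_diagonal]
          simp [mul_inv_cancel₀ (hpos _).ne', h1]
  have htr : (G - (-β) • (1 : Matrix ι ι ℝ))⁻¹.trace ≤ 2 * n := by
    rw [hinv, Matrix.trace_mul_comm, ← Matrix.mul_assoc, h2, Matrix.one_mul,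
      Matrix.trace_diagonal]
    calc ∑ i, (w i + β)⁻¹ ≤ ∑ i, (1 + if w i < 1 then β⁻¹ else 0) := by
          refine Finset.sum_le_sum fun i _ => ?_
          split_ifs with hi
          · have := inv_anti₀ hβ0 (by linarith [hw i] : β ≤ w i + β)
            linarith
          · rw [add_zero]
            exact inv_le_one_of_one_le₀ (by linarith [not_lt.1 hi])
      _ = n + (Finset.univ.filter fun i => w i < 1).card * β⁻¹ := by
          rw [Finset.sum_add_distrib, ← Finset.sum_filter]
          simp [hn]
      _ ≤ n + k * β⁻¹ := by
          have : ((Finset.univ.filter fun i => w i < 1).card : ℝ) ≤ k := by exact_mod_cast hcard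
          gcongr
      _ = 2 * n := by rw [hβ]; field_simp; ring
  obtain ⟨s, hs, hx⟩ := exists_large_restricted_lower_bound (by positivity : 0 < 2 * n)
    (8 * k) G (-β) hpd htr
  refine ⟨s, hs, fun x hxs => ?_⟩
  have h3 := hx (fun j => ⟪e j, x⟫) (fun j hj => by rw [real_inner_comm]; exact hxs j hj)
  have e1 : (fun j => ⟪e j, x⟫) ⬝ᵥ (fun j => ⟪e j, x⟫) = ‖x‖ ^ 2 := by
    rw [← real_inner_self_eq_norm_sq, ← e.sum_inner_mul_inner x x]
    exact Finset.sum_congr rfl fun j _ => by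
      simp only [real_inner_comm x]
  have e2 : U.mulVec (fun j => ⟪e j, x⟫) = fun i => ⟪f i, x⟫ := by
    ext i
    exact e.sum_inner_mul_inner (f i) x
  have e3 : (fun j => ⟪e j, x⟫) ⬝ᵥ G.mulVec (fun j => ⟪e j, x⟫) = ∑ i, w i * ⟪f i, x⟫ ^ 2 := by
    rw [hG, ← Matrix.mulVec_mulVec, e2, ← Matrix.mulVec_mulVec, Matrix.dotProduct_mulVec,
      Matrix.vecMul_transpose, e2]
    simp only [dotProduct, Matrix.mulVec_diagonal]
    exact Finset.sum_congr rfl fun i _ => by ring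
  rw [e1, e3] at h3
  convert h3 using 2
  rw [hβ]
  push_cast
  field_simp
  ring

/-! ### Ellipsoids and their coordinate projections -/

/-- Every ellipsoid has orthonormal principal axes `f i` with positive lengths `l i`. -/
theorem IsEllipsoid.exists_orthonormalBasis {n : ℕ} {E : Set (EuclideanSpace ℝ (Fin n))}
    (hE : IsEllipsoid E) :
    ∃ (f : OrthonormalBasis (Fin n) ℝ (EuclideanSpace ℝ (Fin n))) (l : Fin n → ℝ),
      (∀ i, 0 < l i) ∧
      E = (fun a : EuclideanSpace ℝ (Fin n) => ∑ i, (l i * a i) • f i) '' closedBall 0 1 := by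
  obtain ⟨T, rfl⟩ := hE
  set V := EuclideanSpace ℝ (Fin n) with hV
  set A : V →L[ℝ] V := (T : V →L[ℝ] V) with hA
  set G : V →L[ℝ] V := A ∘L A.adjoint with hG
  have hAinj : ∀ u, A.adjoint u = 0 → u = 0 := by
    intro u hu
    have h := A.adjoint_inner_left (T.symm u) u
    rw [hu, inner_zero_left] at h
    have : A (T.symm u) = u := T.apply_symm_apply u
    rw [this] at h
    exact inner_self_eq_zero.1 h.symm
  have hGin : ∀ u v, ⟪G u, v⟫ = ⟪A.adjoint u, A.adjoint v⟫ := fun u v =>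
    (A.adjoint_inner_right _ _).symm
  have hGs : (G : V →ₗ[ℝ] V).IsSymmetric := by
    intro u v
    change ⟪G u, v⟫ = ⟪u, G v⟫
    rw [hGin]
    exact A.adjoint_inner_left (A.adjoint v) u
  have hfin : Module.finrank ℝ V = n := by simp [V]
  set f := hGs.eigenvectorBasis hfin with hf
  set m := hGs.eigenvalues hfin with hm
  have hGf : ∀ i, G (f i) = m i • f i := fun i => hGs.apply_eigenvectorBasis hfin i
  have hmpos : ∀ i, 0 < m i := by
    intro i
    have h := hGin (f i) (f i)
    rw [hGf, inner_smul_left, real_inner_self_eq_norm_sq, real_inner_self_eq_norm_sq,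
      f.orthonormal.1 i] at h
    simp only [conj_trivial, one_pow, mul_one] at h
    rw [h]
    have : A.adjoint (f i) ≠ 0 := fun h0 => f.orthonormal.ne_zero i (hAinj _ h0)
    positivity
  refine ⟨f, fun i => √(m i), fun i => Real.sqrt_pos.2 (hmpos i), ?_⟩
  have hl : ∀ i, √(m i) * √(m i) = m i := fun i => Real.mul_self_sqrt (hmpos i).le
  have hl0 : ∀ i, √(m i) ≠ 0 := fun i => (Real.sqrt_pos.2 (hmpos i)).ne'
  -- `g i = A⋆ f i / √(m i)` is an orthonormal basis with `A (g i) = √(m i) f i`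
  set g : Fin n → V := fun i => (√(m i))⁻¹ • A.adjoint (f i) with hg
  have hgo : Orthonormal ℝ g := by
    rw [orthonormal_iff_ite]
    intro i j
    rw [hg]
    simp only [inner_smul_left, inner_smul_right, conj_trivial]
    rw [← hGin, hGf, inner_smul_left, orthonormal_iff_ite.1 f.orthonormal i j]
    split_ifs with hij
    · subst hij
      have := hl0 i
      simp only [conj_trivial, mul_one]
      field_simp
      rw [sq, hl]
    · simp
  let gb : OrthonormalBasis (Fin n) ℝ V := OrthonormalBasis.mk hgo
    (by rw [hgo.linearIndependent.span_eq_top_of_card_eq_finrank' (by simp [hfin])])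
  have hAg : ∀ i, A (gb i) = √(m i) • f i := by
    intro i
    have h := hGf i
    have : gb i = g i := by simp [gb]
    rw [this, hg]
    simp only [map_smul]
    change (√(m i))⁻¹ • G (f i) = _
    rw [h, smul_smul]
    congr 1
    have := hl0 i
    field_simp
    rw [sq, hl]
  have hT : ∀ a : V, A (gb.repr.symm a) = ∑ i, (√(m i) * a i) • f i := by
    intro a
    rw [← gb.sum_repr_symm a, map_sum]
    refine Finset.sum_congr rfl fun i _ => ?_
    rw [map_smul, hAg, smul_smul, mul_comm]
  ext y
  constructor
  · rintro ⟨x, hx, rfl⟩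
    refine ⟨gb.repr x, by simpa using hx, ?_⟩
    refine (hT _).symm.trans ?_
    rw [LinearIsometryEquiv.symm_apply_apply]
    rfl
  · rintro ⟨a, ha, rfl⟩
    exact ⟨gb.repr.symm a, by simpa using ha, hT a⟩

/-- Duality: `P_σ(S B) ⊇ r D_σ` as soon as `‖S x‖ ≥ r ‖x‖` on `ℝ^σ`, for the symmetric map `S` with
eigenvectors `f i` and eigenvalues `l i`. -/
theorem smul_coordBall_subset_coordProj {n : ℕ}
    (e f : OrthonormalBasis (Fin n) ℝ (EuclideanSpace ℝ (Fin n))) (σ : Finset (Fin n))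
    (l : Fin n → ℝ) {r : ℝ} (hr : 0 < r)
    (h : ∀ x ∈ coordSubspace e σ, r ^ 2 * ‖x‖ ^ 2 ≤ ∑ i, l i ^ 2 * ⟪f i, x⟫ ^ 2) :
    r • coordBall e σ ⊆ coordProj e σ
      ((fun a : EuclideanSpace ℝ (Fin n) => ∑ i, (l i * a i) • f i) '' closedBall 0 1) := by
  set V := EuclideanSpace ℝ (Fin n) with hV
  -- the symmetric map with eigenvectors `f i` and eigenvalues `l i ^ 2`
  let G : V →ₗ[ℝ] V := ∑ i, (l i ^ 2) • ((innerₛₗ ℝ (f i)).smulRight (f i))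
  have hG : ∀ x, G x = ∑ i, (l i ^ 2 * ⟪f i, x⟫) • f i := by
    intro x
    simp [G, LinearMap.sum_apply, smul_smul]
  have hGx : ∀ x, ⟪G x, x⟫ = ∑ i, l i ^ 2 * ⟪f i, x⟫ ^ 2 := by
    intro x
    rw [hG, sum_inner]
    refine Finset.sum_congr rfl fun i _ => ?_
    rw [inner_smul_left]
    simp only [conj_trivial]
    ring
  set W := coordSubspace e σ with hW
  -- the compression of `G` to `W` is injective, hence surjective
  let Q : W →ₗ[ℝ] W := (W.orthogonalProjectionOnto : V →ₗ[ℝ] W) ∘ₗ G ∘ₗ W.subtype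
  have hQ : ∀ u : W, ⟪(Q u : V), (u : V)⟫ = ∑ i, l i ^ 2 * ⟪f i, (u : V)⟫ ^ 2 := by
    intro u
    rw [← hGx]
    change ⟪W.starProjection (G u), (u : V)⟫ = _
    rw [W.inner_starProjection_left_eq_right, Submodule.starProjection_eq_self_iff.2 u.2]
  have hQinj : Function.Injective Q := by
    rw [← LinearMap.ker_eq_bot, LinearMap.ker_eq_bot']
    intro u hu
    have h1 := h u u.2
    rw [← hQ, hu] at h1
    simp only [ZeroMemClass.coe_zero, inner_zero_left] at h1
    have h2 : ‖(u : V)‖ ^ 2 ≤ 0 := by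
      by_contra hc
      exact absurd h1 (not_le.2 (mul_pos (pow_pos hr 2) (not_le.1 hc)))
    have : (u : V) = 0 := by
      have := pow_eq_zero_iff (two_ne_zero) |>.1 (le_antisymm h2 (sq_nonneg _))
      exact norm_eq_zero.1 this
    exact Subtype.ext this
  have hQsurj := LinearMap.injective_iff_surjective.1 hQinj
  rintro _ ⟨y, ⟨hy1, hy2⟩, rfl⟩
  obtain ⟨u, hu⟩ := hQsurj ⟨r • y, W.smul_mem r hy2⟩
  have hy1' : ‖y‖ ≤ 1 := by simpa using hy1
  let a : V := WithLp.toLp 2 fun i => l i * ⟪f i, (u : V)⟫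
  have ha : ‖a‖ ^ 2 = ∑ i, l i ^ 2 * ⟪f i, (u : V)⟫ ^ 2 := by
    rw [EuclideanSpace.norm_sq_eq]
    exact Finset.sum_congr rfl fun i _ => by simp [a, mul_pow]
  refine ⟨G u, ⟨a, ?_, ?_⟩, ?_⟩
  · have h1 : r * ‖(u : V)‖ ≤ ‖a‖ := by
      refine abs_le_of_sq_le_sq' ?_ (norm_nonneg _) |>.2
      rw [mul_pow, ha]
      exact h u u.2
    have h2 : ‖a‖ ^ 2 ≤ ‖a‖ := by
      rw [ha, ← hQ, hu]
      change ⟪r • y, (u : V)⟫ ≤ _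
      rw [inner_smul_left]
      calc r * ⟪y, (u : V)⟫ ≤ r * (‖y‖ * ‖(u : V)‖) := by
            gcongr; exact real_inner_le_norm _ _
        _ ≤ r * (1 * ‖(u : V)‖) := by gcongr
        _ ≤ ‖a‖ := by rwa [one_mul]
    rw [mem_closedBall_zero_iff]
    nlinarith [norm_nonneg a]
  · rw [hG]
    exact Finset.sum_congr rfl fun i _ => by congr 1; simp only [a]; ring
  · have := congrArg (Subtype.val) hu
    exact this

/-! ### Volume of a body containing an ellipsoid -/

/-- If `S` contains the sum of `L` and the section of an axis-parallel ellipsoid by the coordinates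
outside `p`, then it is large: over each point of the projection of `L`, the section of `S` contains
a translate of that ellipsoid section, while the section of `L` lies in a ball of radius `ρ`. -/
theorem volume_le_of_coordinate_sections {ι : Type*} [Fintype ι] (p : ι → Prop)
    [DecidablePred p] {l : ι → ℝ} (hl : ∀ i, 0 < l i) {ρ : ℝ} (hρ : 0 < ρ)
    {L S : Set (ι → ℝ)} (hL : MeasurableSet L) (hS : MeasurableSet S)
    (hLρ : ∀ x ∈ L, ∑ i, x i ^ 2 ≤ ρ ^ 2)
    (hLS : ∀ x ∈ L, ∀ z : ι → ℝ, (∀ i, p i → z i = 0) → ∑ i, (z i / l i) ^ 2 ≤ 1 → x + z ∈ S) :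
    ENNReal.ofReal (∏ i : {i // ¬ p i}, l i / ρ) * volume L ≤ volume S := by
  classical
  set c : ℝ := ∏ i : {i // ¬ p i}, l i / ρ with hc
  have hc0 : 0 ≤ c := Finset.prod_nonneg fun i _ => (div_pos (hl i) hρ).le
  set Ψ := MeasurableEquiv.piEquivPiSubtypeProd (fun _ : ι => ℝ) p with hΨ
  have hvol : ∀ A : Set (ι → ℝ), MeasurableSet A →
      volume A = ∫⁻ y : {i // p i} → ℝ, volume (Prod.mk y ⁻¹' (Ψ.symm ⁻¹' A)) := by
    intro A hA
    rw [← (volume_preserving_piEquivPiSubtypeProd (fun _ : ι => ℝ) p).symm.measure_preimage_equiv]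
    exact Measure.prod_apply (Ψ.symm.measurable hA)
  rw [hvol L hL, hvol S hS, ← lintegral_const_mul' _ _ ENNReal.ofReal_ne_top]
  refine lintegral_mono fun y => ?_
  set Ly := Prod.mk y ⁻¹' (Ψ.symm ⁻¹' L) with hLy
  set Sy := Prod.mk y ⁻¹' (Ψ.symm ⁻¹' S) with hSy
  rcases Ly.eq_empty_or_nonempty with h0 | ⟨z₀, hz₀⟩
  · rw [h0, measure_empty, mul_zero]; exact zero_le
  have hΨp : ∀ (z : {i // ¬ p i} → ℝ) (i : ι) (hi : p i), Ψ.symm (y, z) i = y ⟨i, hi⟩ := by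
    intro z i hi
    simp [hΨ, MeasurableEquiv.piEquivPiSubtypeProd, Equiv.piEquivPiSubtypeProd, hi]
  have hΨn : ∀ (z : {i // ¬ p i} → ℝ) (i : ι) (hi : ¬ p i), Ψ.symm (y, z) i = z ⟨i, hi⟩ := by
    intro z i hi
    simp [hΨ, MeasurableEquiv.piEquivPiSubtypeProd, Equiv.piEquivPiSubtypeProd, hi]
  -- the section of `L` lies in a ball, which the diagonal map `D` sends into a translate of `Sy`
  set B : Set ({i // ¬ p i} → ℝ) := {z | ∑ i, z i ^ 2 ≤ ρ ^ 2} with hB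
  set D : ({i // ¬ p i} → ℝ) →ₗ[ℝ] ({i // ¬ p i} → ℝ) :=
    Matrix.toLin' (Matrix.diagonal fun i : {i // ¬ p i} => l i / ρ) with hD
  have hDapp : ∀ z i, D z i = l i / ρ * z i := by
    intro z i
    rw [hD, Matrix.toLin'_apply, Matrix.mulVec_diagonal]
  have hdet : LinearMap.det D = c := by
    rw [hD, LinearMap.det_toLin', Matrix.det_diagonal]
  have hLB : Ly ⊆ B := by
    intro z hz
    have h1 := hLρ _ hz
    rw [← Fintype.sum_subtype_add_sum_subtype p] at h1
    have h2 : ∑ i : {i // ¬ p i}, Ψ.symm (y, z) i ^ 2 = ∑ i, z i ^ 2 :=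
      Finset.sum_congr rfl fun i _ => by rw [hΨn z i i.2]
    have h3 : 0 ≤ ∑ i : {i // p i}, Ψ.symm (y, z) i ^ 2 :=
      Finset.sum_nonneg fun i _ => sq_nonneg _
    rw [h2] at h1
    change ∑ i, z i ^ 2 ≤ ρ ^ 2
    linarith
  have hBS : (fun z => z₀ + z) '' (D '' B) ⊆ Sy := by
    rintro _ ⟨_, ⟨z, hz, rfl⟩, rfl⟩
    have h1 := hLS _ hz₀ (fun i => if hi : p i then 0 else D z ⟨i, hi⟩)
      (fun i hi => by simp [hi]) ?_
    · change Ψ.symm (y, z₀ + D z) ∈ S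
      convert h1 using 1
      ext i
      by_cases hi : p i
      · simp [hΨp _ i hi, hi]
      · simp [hΨn _ i hi, hi]
    · rw [← Fintype.sum_subtype_add_sum_subtype p]
      have h2 : ∑ i : {i // p i},
          ((if hi : p i then 0 else D z ⟨i, hi⟩) / l i) ^ 2 = 0 :=
        Finset.sum_eq_zero fun i _ => by simp [i.2]
      have h3 : ∑ i : {i // ¬ p i},
          ((if hi : p i then 0 else D z ⟨i, hi⟩) / l i) ^ 2 = (∑ i, z i ^ 2) / ρ ^ 2 := by
        rw [Finset.sum_div]
        refine Finset.sum_congr rfl fun i _ => ?_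
        rw [dif_neg i.2, hDapp]
        have := (hl i).ne'
        field_simp
      rw [h2, h3, zero_add]
      exact div_le_one_of_le₀ hz (sq_nonneg ρ)
  calc ENNReal.ofReal c * volume Ly ≤ ENNReal.ofReal c * volume B := by
        gcongr
    _ = volume (D '' B) := by
        rw [Measure.addHaar_image_linearMap, hdet, abs_of_nonneg hc0]
    _ = volume ((fun z => z₀ + z) '' (D '' B)) := by
        rw [image_add_left, measure_preimage_add]
    _ ≤ volume Sy := measure_mono hBS

/-- The coordinate map `x ↦ (⟪f i, x⟫)ᵢ` of an orthonormal basis, with values in the plain product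
`Fin n → ℝ`, where Fubini's theorem is available. -/
noncomputable def OrthonormalBasis.coords {n : ℕ}
    (f : OrthonormalBasis (Fin n) ℝ (EuclideanSpace ℝ (Fin n))) :
    EuclideanSpace ℝ (Fin n) ≃L[ℝ] (Fin n → ℝ) :=
  f.repr.toContinuousLinearEquiv.trans (EuclideanSpace.equiv (Fin n) ℝ)

theorem OrthonormalBasis.coords_apply {n : ℕ}
    (f : OrthonormalBasis (Fin n) ℝ (EuclideanSpace ℝ (Fin n))) (x : EuclideanSpace ℝ (Fin n))
    (i : Fin n) : f.coords x i = ⟪f i, x⟫ :=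
  f.repr_apply_apply x i

theorem OrthonormalBasis.sum_coords_smul {n : ℕ}
    (f : OrthonormalBasis (Fin n) ℝ (EuclideanSpace ℝ (Fin n))) (z : Fin n → ℝ) :
    ∑ i, z i • f i = f.coords.symm z :=
  f.sum_repr_symm (WithLp.toLp 2 z)

theorem OrthonormalBasis.volume_image_coords {n : ℕ}
    (f : OrthonormalBasis (Fin n) ℝ (EuclideanSpace ℝ (Fin n)))
    (A : Set (EuclideanSpace ℝ (Fin n))) : volume (f.coords '' A) = volume A := by
  have h : MeasurePreserving f.coords :=
    (PiLp.volume_preserving_ofLp (Fin n)).comp f.measurePreserving_repr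
  rw [← h.measure_preimage_emb f.coords.toHomeomorph.measurableEmbedding,
    preimage_image_eq _ f.coords.injective]

theorem volumeReal_image_axes {n : ℕ}
    (f : OrthonormalBasis (Fin n) ℝ (EuclideanSpace ℝ (Fin n)))
    {l : Fin n → ℝ} (hl : ∀ i, 0 < l i) (A : Set (EuclideanSpace ℝ (Fin n))) :
    volume.real ((fun a : EuclideanSpace ℝ (Fin n) => ∑ i, (l i * a i) • f i) '' A) =
      (∏ i, l i) * volume.real A := by
  have h1 : f.coords '' ((fun a : EuclideanSpace ℝ (Fin n) => ∑ i, (l i * a i) • f i) '' A) =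
      Matrix.toLin' (Matrix.diagonal l) ''
        ((EuclideanSpace.basisFun (Fin n) ℝ).coords '' A) := by
    rw [image_image, image_image]
    refine image_congr fun a _ => ?_
    rw [f.sum_coords_smul fun i => l i * a i, ContinuousLinearEquiv.apply_symm_apply]
    ext i
    rw [Matrix.toLin'_apply, Matrix.mulVec_diagonal, OrthonormalBasis.coords_apply,
      EuclideanSpace.basisFun_inner]
  rw [measureReal_def, ← f.volume_image_coords, h1, Measure.addHaar_image_linearMap,
    LinearMap.det_toLin', Matrix.det_diagonal, OrthonormalBasis.volume_image_coords,
    ENNReal.toReal_mul, ENNReal.toReal_ofReal (abs_nonneg _),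
    abs_of_pos (Finset.prod_pos fun i _ => hl i), measureReal_def]

/-- If `K` contains an ellipsoid with axes `l i` and at least half of the ball of radius `ρ`, then few
axes are much shorter than `ρ`, unless the volume of `K` is much larger than that of the ellipsoid. -/
theorem prod_div_axes_mul_volume_le {n : ℕ}
    (f : OrthonormalBasis (Fin n) ℝ (EuclideanSpace ℝ (Fin n)))
    {l : Fin n → ℝ} (hl : ∀ i, 0 < l i) {K : Set (EuclideanSpace ℝ (Fin n))}
    (hK : IsCompact K) (hKc : Convex ℝ K)
    (hEK : (fun a : EuclideanSpace ℝ (Fin n) => ∑ i, (l i * a i) • f i) '' closedBall 0 1 ⊆ K)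
    {ρ : ℝ} (hρ : 0 < ρ)
    (hvol : ρ ^ n * (volume.real (closedBall (0 : EuclideanSpace ℝ (Fin n)) 1) / 2) ≤
      volume.real (K ∩ closedBall 0 ρ)) (J : Finset (Fin n)) :
    (∏ i ∈ J, ρ / l i) *
        volume.real ((fun a : EuclideanSpace ℝ (Fin n) => ∑ i, (l i * a i) • f i) ''
          closedBall 0 1) ≤ 2 * 2 ^ n * volume.real K := by
  set L : Set (EuclideanSpace ℝ (Fin n)) := K ∩ closedBall 0 ρ with hL
  have hLc : IsCompact L := hK.inter_right isClosed_closedBall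
  have h2K : IsCompact ((2 : ℝ) • K) := hK.smul 2
  have key := volume_le_of_coordinate_sections (fun i => i ∈ J) hl hρ
    (L := f.coords '' L) (S := f.coords '' ((2 : ℝ) • K))
    (hLc.image f.coords.continuous).measurableSet (h2K.image f.coords.continuous).measurableSet
    ?_ ?_
  · rw [f.volume_image_coords, f.volume_image_coords, Measure.addHaar_smul] at key
    have hc0 : 0 ≤ ∏ i : {i // i ∉ J}, l i / ρ :=
      Finset.prod_nonneg fun i _ => (div_pos (hl i) hρ).le
    have key' : (∏ i : {i // i ∉ J}, l i / ρ) * volume.real L ≤ 2 ^ n * volume.real K := by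
      have := ENNReal.toReal_mono
        (ENNReal.mul_ne_top ENNReal.ofReal_ne_top hK.measure_lt_top.ne) key
      rw [ENNReal.toReal_mul, ENNReal.toReal_mul, ENNReal.toReal_ofReal hc0,
        ENNReal.toReal_ofReal (abs_nonneg _)] at this
      rw [abs_of_nonneg (by positivity), finrank_euclideanSpace_fin] at this
      exact this
    have e1 : (∏ i ∈ J, ρ / l i) * (∏ i, l i) = (∏ i : {i // i ∉ J}, l i / ρ) * ρ ^ n := by
      have h3 : ∏ i : {i // i ∉ J}, l i / ρ = ∏ i ∈ Jᶜ, l i / ρ :=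
      (Finset.prod_subtype Jᶜ (by simp) fun i => l i / ρ).symm
      have h4 : (∏ i ∈ Jᶜ, l i / ρ) * ρ ^ Jᶜ.card = ∏ i ∈ Jᶜ, l i := by
        rw [← Finset.prod_const, ← Finset.prod_mul_distrib]
        exact Finset.prod_congr rfl fun i _ => div_mul_cancel₀ _ hρ.ne'
      have h5 : (∏ i ∈ J, ρ / l i) * ∏ i ∈ J, l i = ρ ^ J.card := by
        rw [← Finset.prod_const, ← Finset.prod_mul_distrib]
        exact Finset.prod_congr rfl fun i _ => div_mul_cancel₀ _ (hl i).ne'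
      have h6 : ρ ^ n = ρ ^ J.card * ρ ^ Jᶜ.card := by
        rw [← pow_add, Finset.card_add_card_compl, Fintype.card_fin]
      rw [h3, h6, ← h5, ← Finset.prod_mul_prod_compl J l, ← h4]
      ring
    rw [volumeReal_image_axes f hl, ← mul_assoc, e1]
    have := mul_le_mul_of_nonneg_left hvol hc0
    linarith
  · rintro _ ⟨x, hx, rfl⟩
    have h1 : ‖x‖ ≤ ρ := by simpa using hx.2
    have h2 : ∑ i, f.coords x i ^ 2 = ‖x‖ ^ 2 := by
      rw [← real_inner_self_eq_norm_sq, ← f.sum_inner_mul_inner x x]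
      refine Finset.sum_congr rfl fun i _ => ?_
      rw [OrthonormalBasis.coords_apply, real_inner_comm x, sq]
    rw [h2]
    gcongr
  · rintro _ ⟨x, hx, rfl⟩ z - hz
    set w : EuclideanSpace ℝ (Fin n) := f.coords.symm z with hw
    have hwK : w ∈ K := by
      refine hEK ⟨WithLp.toLp 2 fun i => z i / l i, ?_, ?_⟩
      · rw [mem_closedBall_zero_iff, ← sq_le_one_iff₀ (norm_nonneg _),
          EuclideanSpace.norm_sq_eq]
        simpa only [Real.norm_eq_abs, sq_abs] using hz
      · rw [hw, ← f.sum_coords_smul]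
        refine Finset.sum_congr rfl fun i _ => ?_
        congr 1
        exact mul_div_cancel₀ _ (hl i).ne'
    refine ⟨x + w, ?_, by rw [map_add, hw, ContinuousLinearEquiv.apply_symm_apply]⟩
    refine ⟨(1 / 2 : ℝ) • x + (1 / 2 : ℝ) • w,
      hKc hx.1 hwK (by norm_num) (by norm_num) (by norm_num), ?_⟩
    change (2 : ℝ) • _ = _
    module

/-! ### The mean norm and volume -/

theorem mem_nhds_zero_of_symmetric {V : Type*} [NormedAddCommGroup V] [NormedSpace ℝ V]
    {K : Set V} (hK : Convex ℝ K) (hsymm : ∀ x ∈ K, -x ∈ K) (hint : (interior K).Nonempty) :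
    K ∈ nhds (0 : V) := by
  obtain ⟨x, hx⟩ := hint
  have hx' : -x ∈ K := hsymm x (interior_subset hx)
  have := hK.combo_interior_self_mem_interior hx hx' (by norm_num : (0 : ℝ) < 1 / 2)
    (by norm_num : (0 : ℝ) ≤ 1 / 2) (by norm_num)
  rw [smul_neg, add_neg_cancel] at this
  exact mem_interior_iff_mem_nhds.1 this

/-- By Markov's inequality, `‖x‖_K < √2 M_K` on half of the sphere, and the cone over that half,
scaled by `ρ = 1 / (√2 M_K)`, lies in `K`. -/
theorem half_volume_closedBall_le_volume_inter {n : ℕ} (hn : 1 ≤ n)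
    {K : Set (EuclideanSpace ℝ (Fin n))} (hK : Convex ℝ K) (hK0 : K ∈ nhds 0)
    (hKb : IsCompact K)
    (hM : 0 < meanNorm K) {ρ : ℝ} (hρ : ρ = 1 / (√2 * meanNorm K)) :
    ρ ^ n * (volume.real (closedBall (0 : EuclideanSpace ℝ (Fin n)) 1) / 2) ≤
      volume.real (K ∩ closedBall 0 ρ) := by
  set M := meanNorm K with hMdef
  have hρ0 : 0 < ρ := by rw [hρ]; positivity
  set τ := (volume : Measure (EuclideanSpace ℝ (Fin n))).toSphere with hτ
  have hfin : Module.finrank ℝ (EuclideanSpace ℝ (Fin n)) = n := by simp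
  have : Nontrivial (EuclideanSpace ℝ (Fin n)) :=
    Module.nontrivial_of_finrank_pos (R := ℝ) (by rw [hfin]; exact hn)
  have hτu : τ.real univ = n * volume.real (closedBall (0 : EuclideanSpace ℝ (Fin n)) 1) := by
    rw [hτ, Measure.toSphere_real_apply_univ, hfin, measureReal_def, measureReal_def,
      Measure.addHaar_closedBall_eq_addHaar_ball]
  have hn0 : (0 : ℝ) < n := by exact_mod_cast hn
  have hBpos : 0 < volume.real (closedBall (0 : EuclideanSpace ℝ (Fin n)) 1) :=
    ENNReal.toReal_pos (measure_closedBall_pos _ _ one_pos).ne' measure_closedBall_lt_top.ne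
  have hτpos : 0 < τ.real univ := by rw [hτu]; positivity
  set g : sphere (0 : EuclideanSpace ℝ (Fin n)) 1 → ℝ :=
    fun x => gauge K (x : EuclideanSpace ℝ (Fin n)) ^ 2 with hg
  have hgc : Continuous g := ((continuous_gauge hK hK0).comp continuous_subtype_val).pow 2
  have hgi : Integrable g τ := hgc.integrable_of_hasCompactSupport
    (HasCompactSupport.of_compactSpace g)
  have hM2 : ∫ x, g x ∂τ = τ.real univ * M ^ 2 := by
    have h0 : 0 ≤ ∫ x, g x ∂(sphereProbability n) := integral_nonneg fun x => sq_nonneg _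
    have h1 : M ^ 2 = ∫ x, g x ∂(sphereProbability n) := by
      rw [hMdef, meanNorm, Real.sq_sqrt h0]
    rw [h1, sphereProbability, integral_smul_measure, ENNReal.toReal_inv, smul_eq_mul,
      ← mul_assoc]
    change _ = τ.real univ * (τ.real univ)⁻¹ * _
    rw [mul_inv_cancel₀ hτpos.ne', one_mul]
  have hmark := mul_meas_ge_le_integral_of_nonneg (μ := τ) (f := g)
    (Filter.Eventually.of_forall fun x => sq_nonneg _) hgi (2 * M ^ 2)
  set A : Set (sphere (0 : EuclideanSpace ℝ (Fin n)) 1) := {x | g x < 2 * M ^ 2} with hA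
  have hAm : MeasurableSet A := (isOpen_lt hgc continuous_const).measurableSet
  have hAc : {x | 2 * M ^ 2 ≤ g x} = Aᶜ := by ext x; simp [hA]
  rw [hAc, hM2, measureReal_compl hAm] at hmark
  have hhalf : τ.real univ / 2 ≤ τ.real A := by
    have : 0 < M ^ 2 := by positivity
    nlinarith
  have hAr : τ.real A =
      n * volume.real (Ioo (0 : ℝ) 1 • ((↑) '' A : Set (EuclideanSpace ℝ (Fin n)))) := by
    rw [hτ, measureReal_def, Measure.toSphere_apply' _ hAm, ENNReal.toReal_mul, hfin]
    rfl
  rw [hAr, hτu] at hhalf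
  have hhalf' : volume.real (closedBall (0 : EuclideanSpace ℝ (Fin n)) 1) / 2 ≤
      volume.real (Ioo (0 : ℝ) 1 • ((↑) '' A : Set (EuclideanSpace ℝ (Fin n)))) := by
    nlinarith
  have hsub : ρ • (Ioo (0 : ℝ) 1 • ((↑) '' A : Set (EuclideanSpace ℝ (Fin n)))) ⊆
      K ∩ closedBall 0 ρ := by
    rintro _ ⟨_, ⟨s, hs, _, ⟨x, hx, rfl⟩, rfl⟩, rfl⟩
    have hx1 : ‖(x : EuclideanSpace ℝ (Fin n))‖ = 1 := by simp
    constructor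
    · refine setOfPred_gauge_lt_one_subset_self hK (mem_of_mem_nhds hK0) (absorbent_nhds_zero hK0) ?_
      change gauge K (ρ • s • (x : EuclideanSpace ℝ (Fin n))) < 1
      rw [gauge_smul_of_nonneg hρ0.le, gauge_smul_of_nonneg hs.1.le]
      have h1 : gauge K (x : EuclideanSpace ℝ (Fin n)) < √2 * M := by
        refine lt_of_pow_lt_pow_left₀ 2 (by positivity) ?_
        rw [mul_pow, Real.sq_sqrt (by norm_num)]
        exact hx
      have h2 : ρ * (√2 * M) = 1 := by rw [hρ]; field_simp
      have h3 : s * gauge K (x : EuclideanSpace ℝ (Fin n)) ≤ gauge K (x : EuclideanSpace ℝ (Fin n)) :=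
        mul_le_of_le_one_left (gauge_nonneg _) hs.2.le
      simp only [smul_eq_mul]
      calc ρ * (s * gauge K (x : EuclideanSpace ℝ (Fin n))) < ρ * (√2 * M) :=
            mul_lt_mul_of_pos_left (h3.trans_lt h1) hρ0
        _ = 1 := h2
    · rw [mem_closedBall_zero_iff]
      change ‖ρ • s • (x : EuclideanSpace ℝ (Fin n))‖ ≤ ρ
      rw [norm_smul, norm_smul, hx1, mul_one, Real.norm_of_nonneg hρ0.le,
        Real.norm_of_nonneg hs.1.le]
      exact mul_le_of_le_one_right hρ0.le hs.2.le
  calc ρ ^ n * (volume.real (closedBall (0 : EuclideanSpace ℝ (Fin n)) 1) / 2) ≤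
        ρ ^ n * volume.real (Ioo (0 : ℝ) 1 • ((↑) '' A : Set (EuclideanSpace ℝ (Fin n)))) := by gcongr
    _ = volume.real (ρ • (Ioo (0 : ℝ) 1 • ((↑) '' A : Set (EuclideanSpace ℝ (Fin n))))) := by
        rw [measureReal_def, measureReal_def, Measure.addHaar_smul, ENNReal.toReal_mul,
          ENNReal.toReal_ofReal (abs_nonneg _), hfin, abs_of_nonneg (by positivity)]
    _ ≤ _ := measureReal_mono hsub
        (ne_top_of_le_ne_top hKb.measure_lt_top.ne (measure_mono inter_subset_left))

/-! ### Large coordinate projections -/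

theorem smul_coordBall_subset_smul {n : ℕ}
    (e : OrthonormalBasis (Fin n) ℝ (EuclideanSpace ℝ (Fin n))) (σ : Finset (Fin n))
    {c r : ℝ} (hc : 0 ≤ c) (hcr : c ≤ r) (hr : 0 < r) :
    c • coordBall e σ ⊆ r • coordBall e σ := by
  rintro _ ⟨y, ⟨hy1, hy2⟩, rfl⟩
  refine ⟨(c / r) • y, ⟨?_, (coordSubspace e σ).smul_mem _ hy2⟩, ?_⟩
  · rw [mem_closedBall_zero_iff] at hy1 ⊢
    rw [norm_smul, Real.norm_of_nonneg (by positivity)]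
    exact mul_le_one₀ (div_le_one_of_le₀ hcr hr.le) (norm_nonneg _) hy1
  · change r • (c / r) • y = c • y
    rw [smul_smul, mul_div_cancel₀ _ hr.ne']

/-- The polynomial factor `1 / √θ` is absorbed by the power of `a`, as `log a ≥ 1` and
`1 / θ ≤ exp (log (2 / θ))`. -/
theorem rpow_exponent_bound {a θ : ℝ} (ha : 4 ≤ a) (hθ0 : 0 < θ) (hθ1 : θ < 1) :
    4 * √2 / √θ * a ^ (8 / θ) ≤ a ^ (15 * Real.log (2 / θ) / θ) := by
  have ha0 : 0 < a := by linarith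
  set b := Real.log (2 / θ) with hb
  have hb2 : 2 / 3 ≤ b := by
    have h1 : Real.log 2 ≤ b := Real.log_le_log (by norm_num) (by
      rw [le_div_iff₀ hθ0]; linarith)
    linarith [Real.log_two_gt_d9]
  have hexp : Real.exp b = 2 / θ := Real.exp_log (by positivity)
  have h2 : 4 * √2 / √θ ≤ a ^ (3 * b / θ) := by
    have hs2 : √2 ≤ 3 / 2 := by
      rw [Real.sqrt_le_left (by norm_num)]; norm_num
    have hsθ : θ ≤ √θ := Real.le_sqrt_of_sq_le (by nlinarith)
    calc 4 * √2 / √θ ≤ 4 * (3 / 2) / θ := by gcongr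
      _ = 2 / θ * 3 := by ring
      _ ≤ 2 / θ * (2 / θ) ^ 2 := by
          have h3 : 2 ≤ 2 / θ := by rw [le_div_iff₀ hθ0]; linarith
          gcongr
          nlinarith
      _ = Real.exp (3 * b) := by
          rw [← hexp, ← Real.exp_nat_mul, ← Real.exp_add]
          congr 1; push_cast; ring
      _ ≤ Real.exp (Real.log a * (3 * b / θ)) := by
          rw [Real.exp_le_exp]
          have hl : 1 ≤ Real.log a := by
            rw [Real.le_log_iff_exp_le ha0]
            linarith [Real.exp_one_lt_d9]
          have h4 : 3 * b ≤ 3 * b / θ := by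
            rw [le_div_iff₀ hθ0]; nlinarith
          nlinarith
      _ = a ^ (3 * b / θ) := (Real.rpow_def_of_pos ha0 _).symm
  calc 4 * √2 / √θ * a ^ (8 / θ) ≤ a ^ (3 * b / θ) * a ^ (12 * b / θ) := by
        gcongr
        · linarith
        · linarith
    _ = a ^ (15 * b / θ) := by
        rw [← Real.rpow_add ha0]; congr 1; ring

theorem card_small_axes_le {n : ℕ} (hn : 1 ≤ n) {l : Fin n → ℝ} (hl : ∀ i, 0 < l i)
    {ρ v θ : ℝ} (hρ : 0 < ρ) (hv : 1 ≤ v) (hθ0 : 0 < θ)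
    (h : ∀ J : Finset (Fin n), ∏ i ∈ J, ρ / l i ≤ 2 * 2 ^ n * v ^ n) :
    (Finset.univ.filter fun i => l i < ρ * (4 * v) ^ (-(8 / θ))).card ≤ ⌊θ * n / 8⌋₊ := by
  by_contra! hc
  set J := Finset.univ.filter fun i => l i < ρ * (4 * v) ^ (-(8 / θ)) with hJ
  have hcJ : θ * n / 8 < J.card := Nat.lt_of_floor_lt hc
  have h4v : 0 < 4 * v := by linarith
  have h1 : ((4 * v) ^ (8 / θ)) ^ J.card ≤ ∏ i ∈ J, ρ / l i := by
    rw [← Finset.prod_const]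
    refine Finset.prod_le_prod (fun i _ => by positivity) fun i hi => ?_
    have hi' : l i < ρ * (4 * v) ^ (-(8 / θ)) := (Finset.mem_filter.1 hi).2
    rw [Real.rpow_neg h4v.le, ← div_eq_mul_inv, lt_div_iff₀ (by positivity)] at hi'
    rw [le_div_iff₀ (hl i)]
    linarith
  have h2 : (4 * v) ^ n < ((4 * v) ^ (8 / θ)) ^ J.card := by
    rw [← Real.rpow_natCast, ← Real.rpow_natCast, ← Real.rpow_mul h4v.le]
    refine Real.rpow_lt_rpow_of_exponent_lt (by linarith) ?_
    rw [div_mul_eq_mul_div, lt_div_iff₀ hθ0]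
    linarith
  have h3 : 2 * 2 ^ n * v ^ n ≤ (4 * v) ^ n := by
    have h5 : (2 : ℝ) ≤ 2 ^ n := by
      calc (2 : ℝ) = 2 ^ 1 := by norm_num
        _ ≤ 2 ^ n := pow_le_pow_right₀ (by norm_num) hn
    calc 2 * 2 ^ n * v ^ n ≤ 2 ^ n * 2 ^ n * v ^ n := by gcongr
      _ = (4 * v) ^ n := by rw [← mul_pow, ← mul_pow]; norm_num
  exact absurd (h J) (not_le.2 (by linarith))

theorem exists_coordinate_ball_in_ellipsoid {n : ℕ} (hn : 1 ≤ n)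
    (e f : OrthonormalBasis (Fin n) ℝ (EuclideanSpace ℝ (Fin n))) {l : Fin n → ℝ}
    {r₀ θ : ℝ} (hr₀ : 0 < r₀) (hl : ∀ i, 0 < l i) (hθ0 : 0 < θ) (hθ1 : θ < 1)
    (h : (Finset.univ.filter fun i => l i < r₀).card ≤ ⌊θ * n / 8⌋₊) :
    ∃ σ : Finset (Fin n), (1 - θ) * n ≤ σ.card ∧
      (r₀ * (√θ / 4)) • coordBall e σ ⊆ coordProj e σ
        ((fun a : EuclideanSpace ℝ (Fin n) => ∑ i, (l i * a i) • f i) '' closedBall 0 1) := by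
  have hn0 : (0 : ℝ) < n := by exact_mod_cast hn
  have hr : 0 < r₀ * (√θ / 4) := by positivity
  have hsq : (r₀ * (√θ / 4)) ^ 2 = r₀ ^ 2 * (θ / 16) := by
    rw [mul_pow, div_pow, Real.sq_sqrt hθ0.le]; norm_num
  set k := ⌊θ * n / 8⌋₊ with hk
  have hkle : (k : ℝ) ≤ θ * n / 8 := Nat.floor_le (by positivity)
  -- if `k = 0` no axis is short and all coordinates are kept
  rcases Nat.eq_zero_or_pos k with hk0 | hk0
  · refine ⟨Finset.univ, by simp; nlinarith, smul_coordBall_subset_coordProj e f _ l hr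
      fun x _ => ?_⟩
    rw [hk0, Nat.le_zero, Finset.card_eq_zero, Finset.filter_eq_empty_iff] at h
    have hx : ‖x‖ ^ 2 = ∑ i, ⟪f i, x⟫ ^ 2 := by
      rw [← real_inner_self_eq_norm_sq, ← f.sum_inner_mul_inner x x]
      exact Finset.sum_congr rfl fun i _ => by rw [real_inner_comm x, sq]
    rw [hsq, hx, Finset.mul_sum]
    refine Finset.sum_le_sum fun i _ => ?_
    have h1 : r₀ ≤ l i := not_lt.1 (h (Finset.mem_univ i))
    have h2 : r₀ ^ 2 * (θ / 16) ≤ l i ^ 2 := by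
      calc r₀ ^ 2 * (θ / 16) ≤ r₀ ^ 2 * 1 := by gcongr; linarith
        _ ≤ l i ^ 2 := by rw [mul_one]; gcongr
    gcongr
  · have hcard : (Finset.univ.filter fun i => (l i / r₀) ^ 2 < 1).card ≤ k := by
      convert h using 3 with i
      rw [sq_lt_one_iff₀ (div_pos (hl i) hr₀).le, div_lt_one hr₀]
    obtain ⟨σ, hσ, hx⟩ := exists_coordinate_lower_bound e f (fun i => (l i / r₀) ^ 2)
      (fun i => sq_nonneg _) hk0 hcard
    rw [Fintype.card_fin] at hσ hx
    refine ⟨σ, ?_, smul_coordBall_subset_coordProj e f _ l hr fun x hxσ => ?_⟩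
    · have : (n : ℝ) ≤ σ.card + 8 * k := by exact_mod_cast hσ
      linarith
    · have h1 := hx x hxσ
      have h2 : θ / 16 ≤ k / n := by
        rw [le_div_iff₀ hn0]
        have h3 : θ * n / 8 < k + 1 := Nat.lt_floor_add_one _
        have h4 : (1 : ℝ) ≤ k := by exact_mod_cast hk0
        linarith
      calc (r₀ * (√θ / 4)) ^ 2 * ‖x‖ ^ 2 = r₀ ^ 2 * (θ / 16 * ‖x‖ ^ 2) := by rw [hsq]; ring
        _ ≤ r₀ ^ 2 * (k / n * ‖x‖ ^ 2) := by gcongr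
        _ ≤ r₀ ^ 2 * ∑ i, (l i / r₀) ^ 2 * ⟪f i, x⟫ ^ 2 := by gcongr
        _ = ∑ i, l i ^ 2 * ⟪f i, x⟫ ^ 2 := by
            rw [Finset.mul_sum]
            refine Finset.sum_congr rfl fun i _ => ?_
            field_simp

theorem theorem4p4 :
    ∃ c₁ c₂ : ℝ, 0 < c₁ ∧ 0 < c₂ ∧
      ∀ (n : ℕ) (_hn : 1 ≤ n)
        (e : OrthonormalBasis (Fin n) ℝ (EuclideanSpace ℝ (Fin n)))
        (K : ConvexBody (EuclideanSpace ℝ (Fin n)))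
        (_hsymm : ∀ x ∈ K, -x ∈ K)
        (_hint : (interior (K : Set (EuclideanSpace ℝ (Fin n)))).Nonempty)
        (θ : ℝ) (_hθ0 : 0 < θ) (_hθ1 : θ < 1),
        ∃ σ : Finset (Fin n), (1 - θ) * (n : ℝ) ≤ (σ.card : ℝ) ∧
          (1 / ((c₁ * volumeRatio (K : Set (EuclideanSpace ℝ (Fin n)))) ^
                (c₂ * Real.log (2 / θ) / θ) *
              meanNorm (K : Set (EuclideanSpace ℝ (Fin n))))) • coordBall e σ ⊆
            coordProj e σ (K : Set (EuclideanSpace ℝ (Fin n))) := by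
  -- `12 log (2 / θ) / θ` dominates `8 / θ`, and `3 log (2 / θ) / θ` pays for `4 √2 / √θ`
  refine ⟨4, 15, by norm_num, by norm_num, ?_⟩
  intro n hn e K hsymm hint θ hθ0 hθ1
  set V := EuclideanSpace ℝ (Fin n) with hV
  set M := meanNorm (K : Set V) with hM
  have hn0 : (0 : ℝ) < n := by exact_mod_cast hn
  obtain ⟨E, hE⟩ := exists_isMaxVolumeEllipsoid K hsymm hint
  obtain ⟨f, l, hl, hEl⟩ := hE.1.1.exists_orthonormalBasis
  have hK0 : (K : Set V) ∈ nhds 0 := mem_nhds_zero_of_symmetric K.convex hsymm hint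
  have hMnn : 0 ≤ M := Real.sqrt_nonneg _
  rcases hMnn.eq_or_lt with hM0 | hMpos
  · -- here the radius is zero, as `1 / 0 = 0`; in fact `M` is always positive
    refine ⟨Finset.univ, by simp; nlinarith, ?_⟩
    rw [← hM0, mul_zero, div_zero]
    rintro _ ⟨y, -, rfl⟩
    exact ⟨0, mem_of_mem_nhds hK0, by simp⟩
  set v := volumeRatio (K : Set V) with hv
  have hvE : v = (volume.real (K : Set V) / volume.real E) ^ (1 / (n : ℝ)) := volumeRatio_eq hE
  have hEpos : 0 < volume.real E := by
    rw [hEl, volumeReal_image_axes f hl]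
    exact mul_pos (Finset.prod_pos fun i _ => hl i)
      (ENNReal.toReal_pos (measure_closedBall_pos _ _ one_pos).ne' measure_closedBall_lt_top.ne)
  have hEK : volume.real E ≤ volume.real (K : Set V) :=
    measureReal_mono hE.1.2 K.isCompact.measure_lt_top.ne
  have hv1 : 1 ≤ v := by
    rw [hvE]
    exact Real.one_le_rpow ((one_le_div hEpos).2 hEK) (by positivity)
  have hvn : v ^ n * volume.real E = volume.real (K : Set V) := by
    rw [hvE, ← Real.rpow_natCast, ← Real.rpow_mul (by positivity), one_div_mul_cancel hn0.ne',
      Real.rpow_one, div_mul_cancel₀ _ hEpos.ne']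
  obtain ⟨ρ, hρ⟩ : ∃ ρ : ℝ, ρ = 1 / (√2 * M) := ⟨_, rfl⟩
  have hρ0 : 0 < ρ := by rw [hρ]; positivity
  have hprod : ∀ J : Finset (Fin n), ∏ i ∈ J, ρ / l i ≤ 2 * 2 ^ n * v ^ n := by
    intro J
    have h := prod_div_axes_mul_volume_le f hl K.isCompact K.convex (hEl ▸ hE.1.2) hρ0
      (half_volume_closedBall_le_volume_inter hn K.convex hK0 K.isCompact hMpos hρ) J
    rw [← hEl, ← hvn, ← mul_assoc] at h
    exact le_of_mul_le_mul_right h hEpos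
  have h4v : 0 < 4 * v := by linarith
  obtain ⟨σ, hσ, hsub⟩ := exists_coordinate_ball_in_ellipsoid hn e f
    (by positivity : 0 < ρ * (4 * v) ^ (-(8 / θ))) hl hθ0 hθ1
    (card_small_axes_le hn hl hρ0 hv1 hθ0 hprod)
  rw [← hEl] at hsub
  refine ⟨σ, hσ, ((smul_coordBall_subset_smul e σ (by positivity) ?_ (by positivity)).trans
    hsub).trans (image_mono hE.1.2)⟩
  have h1 := rpow_exponent_bound (by linarith : 4 ≤ 4 * v) hθ0 hθ1
  have h2 : ρ * (4 * v) ^ (-(8 / θ)) * (√θ / 4) =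
      1 / (4 * √2 / √θ * (4 * v) ^ (8 / θ) * M) := by
    have := (Real.sqrt_pos.2 hθ0).ne'
    rw [hρ, Real.rpow_neg h4v.le]
    field_simp
  rw [h2]
  gcongr
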